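/- Let $k$ be a field of characteristic $2$, and let $\mathcal A_1$ be the stack of elliptic curves (one-dimensional principally polarised abelian varieties) over $k$. Then $\operatorname{ed}_k \mathcal A_1 = 2$. Here, for a field extension $L/k$, let $F(L)$ be the set of isomorphism classes of elliptic curves over $L$, that is, of Weierstrass curves $y^2+a_1xy+a_3y=x^3+a_2x^2+a_4x+a_6$ over $L$ with non-zero discriminant, up to admissible changes of variables $x = u^2x'+r$, $y=u^3y'+u^2sx'+t$ with $u\in L^\times$ and $r,s,t\in L$; this is a covariant functor of $L$ by base change. A class $a\in F(L)$ descends to an intermediate field $k\subseteq K\subseteq L$ if it lies in the image of $F(K)\to F(L)$; the essential dimension $\operatorname{ed}_k a$ is the minimum of $\operatorname{tr\,deg}_k K$ over all intermediate fields $K$ to which $a$ descends; and $\operatorname{ed}_k\mathcal A_1$ is the supremum of $\operatorname{ed}_k a$ over all field extensions $L/k$ and all $a\in F(L)$. -/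

import Mathlib

open CategoryTheory

universe u

noncomputable section

/-! ### Essential dimension of functors and stacks on field extensions -/

/-- A field extension `L / k`. -/
structure FieldExt (k : Type u) [Field k] where
  /-- The extension field. -/
  carrier : Type u
  [field : Field carrier]
  [algebra : Algebra k carrier]

namespace FieldExt

attribute [instance] FieldExt.field FieldExt.algebra

variable {k : Type u} [Field k]

/-- The category of field extensions of `k`; the morphisms are the `k`-algebra homomorphisms. -/
instance : Category (FieldExt k) where
  Hom L M := L.carrier →ₐ[k] M.carrier
  id L := AlgHom.id k L.carrier
  comp f g := AlgHom.comp g f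

/-- An intermediate field `k ⊆ K ⊆ L`, as an extension of `k`. -/
def ofIntermediate (L : FieldExt k) (K : IntermediateField k L.carrier) : FieldExt k where
  carrier := K

/-- The inclusion `K ⊆ L` of an intermediate field. -/
def inclusion (L : FieldExt k) (K : IntermediateField k L.carrier) : L.ofIntermediate K ⟶ L :=
  K.val

end FieldExt

section EssentialDimension

variable {k : Type u} [Field k]

/-- The element `a ∈ F(L)` descends to the intermediate field `K`: it lies in the image of
`F(K) → F(L)`. -/
def DescendsTo (F : FieldExt k ⥤ Type u) {L : FieldExt k} (a : F.obj L)
    (K : IntermediateField k L.carrier) : Prop :=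
  ∃ b : F.obj (L.ofIntermediate K), F.map (L.inclusion K) b = a

/-- The essential dimension of an element `a ∈ F(L)`: the minimum of the transcendence degrees over
`k` of the intermediate fields to which `a` descends (`⊤` if these degrees are all infinite). -/
def elementEssentialDimension (F : FieldExt k ⥤ Type u) {L : FieldExt k} (a : F.obj L) : ℕ∞ :=
  ⨅ K : {K : IntermediateField k L.carrier // DescendsTo F a K},
    Cardinal.toENat (Algebra.trdeg k K.1)

/-- The essential dimension of a functor `F` from field extensions of `k` to sets: the supremum of
the essential dimensions of all elements of all `F(L)`. It is `⊥` (that is, `-∞`) if `F` is the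
empty functor. -/
def essentialDimension (F : FieldExt k ⥤ Type u) : WithBot ℕ∞ :=
  ⨆ (L : FieldExt k) (a : F.obj L), (elementEssentialDimension F a : WithBot ℕ∞)

/-- The functor sending a field extension `L / k` to the set of isomorphism classes of objects of
the groupoid `X(L)`. -/
def isoClassFunctor (X : FieldExt k ⥤ Grpd.{u, u}) : FieldExt k ⥤ Type u :=
  X ⋙ Grpd.forgetToCat ⋙ isomorphismClasses

/-- The essential dimension over `k` of a stack `X`, given through its groupoids `X(L)` of sections
over the field extensions `L / k`. -/
def stackEssentialDimension (X : FieldExt k ⥤ Grpd.{u, u}) : WithBot ℕ∞ :=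
  essentialDimension (isoClassFunctor X)

end EssentialDimension

/-! ### The stack of elliptic curves -/

/-- An elliptic curve over a field `L`, in the sense of Mathlib: a Weierstrass curve over `L` with
non-zero discriminant. Over a field these are all elliptic curves up to isomorphism, and the
isomorphisms between them are exactly the admissible changes of variables. -/
structure EllipticCurveOver (L : Type u) [Field L] where
  /-- The underlying Weierstrass curve, pointed by its point at infinity. -/
  curve : WeierstrassCurve L
  isElliptic : curve.IsElliptic

namespace EllipticCurveOver

/-- An isomorphism of elliptic curves over `L`: an admissible change of variables
`(X, Y) ↦ (u²X + r, u³Y + u²sX + t)`, with `u ≠ 0`, `r`, `s`, `t` in `L`, that carries the equation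
of `E` to the equation of `E'`. -/
@[ext]
structure Isom {L : Type u} [Field L] (E E' : EllipticCurveOver L) where
  /-- The change of variables. -/
  change : WeierstrassCurve.VariableChange L
  smul_eq : change • E.curve = E'.curve

/-- The groupoid of elliptic curves over `L` and their isomorphisms. -/
instance (L : Type u) [Field L] : Groupoid (EllipticCurveOver L) where
  Hom E E' := Isom E E'
  id E := ⟨1, one_smul _ _⟩
  comp f g := ⟨g.change * f.change, by rw [mul_smul, f.smul_eq, g.smul_eq]⟩
  inv f := ⟨f.change⁻¹, by rw [← f.smul_eq, inv_smul_smul]⟩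
  id_comp _ := Isom.ext (mul_one _)
  comp_id _ := Isom.ext (one_mul _)
  assoc _ _ _ := Isom.ext (mul_assoc _ _ _).symm
  inv_comp _ := Isom.ext (mul_inv_cancel _)
  comp_inv _ := Isom.ext (inv_mul_cancel _)

/-- The base change functor from elliptic curves over `L` to elliptic curves over `M`. -/
def baseChange {L M : Type u} [Field L] [Field M] (φ : L →+* M) :
    EllipticCurveOver L ⥤ EllipticCurveOver M where
  obj E := ⟨E.curve.map φ, haveI := E.isElliptic; inferInstance⟩
  map {E E'} f := (⟨f.change.map φ, by
    rw [WeierstrassCurve.map_variableChange, f.smul_eq]⟩ : Isom _ _)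
  map_id _ := Isom.ext (map_one (WeierstrassCurve.VariableChange.mapHom φ))
  map_comp f g := Isom.ext
    (map_mul (WeierstrassCurve.VariableChange.mapHom φ) g.change f.change)

end EllipticCurveOver

/-- The stack `𝒜₁` of elliptic curves over `k`, on field extensions of `k`: it sends `L / k` to the
groupoid of elliptic curves over `L`, and `L → M` to base change. (It is the quotient stack of the
scheme of Weierstrass equations with invertible discriminant by the group of changes of variables;
torsors of that group over a field are trivial.) -/
def stackA1 (k : Type u) [Field k] : FieldExt k ⥤ Grpd.{u, u} where
  obj L := Grpd.of (EllipticCurveOver L.carrier)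
  map f := EllipticCurveOver.baseChange f.toRingHom
  map_id _ := rfl
  map_comp _ _ := rfl

end

/-!
The upper bound comes from normal forms. In characteristic `2` every elliptic curve is isomorphic to
one of `Y² + XY = X³ + a₂X² + a₆`, `Y² + a₃Y = X³ + a₆` and `Y² + cY = X³ + cX + a₆`, where the last
two cover `j = 0` and the last arises from `Y² + a₃Y = X³ + a₄X + a₆` by scaling with `u = a₄ / a₃`.
Each involves only two parameters, so the curve is defined over an extension of `k` generated by two
elements (`EllipticCurveOver.exists_isom_two_parameters`).

For the lower bound let `F = k(b)` with `b` transcendental over `k`, and consider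
`E : Y² + XY = X³ + TX² + b` over `F(T)`. Two curves
`Y² + XY = X³ + a₂X² + a₆` are isomorphic only if they have the same `a₆` and their coefficients `a₂`
differ by some `z² + z`. So if `E` descends to `K`, then `b ∈ K`, and `K` also contains some
`c = T - z - z²` with `z ∈ F(T)`. The Artin-Schreier equation `z² + z = T - c` has no solution with
`c ∈ F`, because its right-hand side is a polynomial of odd degree
(`ratFunc_X_sub_sub_sq_ne_C`). Hence `c ∉ F`, so `c` is transcendental over `F`, which is
algebraically closed in `F(T)`, and `b`, `c` are algebraically independent elements of `K`.
-/

/-! ### Fields generated by few elements, and an Artin-Schreier equation -/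

theorem IntermediateField.trdeg_adjoin_le {k L : Type u} [Field k] [Field L] [Algebra k L]
    (S : Set L) : Algebra.trdeg k (IntermediateField.adjoin k S) ≤ Cardinal.mk S := by
  set K := IntermediateField.adjoin k S
  let f : S → K := fun x => ⟨x, IntermediateField.subset_adjoin k S x.2⟩
  have hdiv (x : K) : ∃ a ∈ Algebra.adjoin k (Set.range f),
      ∃ b ∈ Algebra.adjoin k (Set.range f), x = a / b := by
    obtain ⟨r, hr, s, hs, h⟩ := IntermediateField.mem_adjoin_iff_div.mp x.2
    have key : Algebra.adjoin k S = (Algebra.adjoin k (Set.range f)).map K.val := by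
      rw [AlgHom.map_adjoin, ← Set.range_comp]
      congr 1
      ext y
      simp [f]
    rw [key] at hr hs
    obtain ⟨a, ha, rfl⟩ := hr
    obtain ⟨b, hb, rfl⟩ := hs
    exact ⟨a, ha, b, hb, Subtype.ext h⟩
  have : Algebra.IsAlgebraic (Algebra.adjoin k (Set.range f)) K := by
    refine ⟨fun x => ?_⟩
    obtain ⟨a, ha, b, hb, rfl⟩ := hdiv x
    rw [div_eq_mul_inv]
    exact (isAlgebraic_algebraMap (⟨a, ha⟩ : Algebra.adjoin k (Set.range f))).mul
      (isAlgebraic_algebraMap (⟨b, hb⟩ : Algebra.adjoin k (Set.range f))).inv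
  exact (Algebra.IsAlgebraic.trdeg_le_cardinalMk k (Set.range f)).trans Cardinal.mk_range_le

open Polynomial in
/-- The Artin-Schreier equation `z² + z = T - c` has no solution `z ∈ F(T)` if `c ∈ F`: a solution
would be integral over `F[T]`, hence a polynomial, and `z² + z` cannot have degree `1`. -/
theorem ratFunc_X_sub_sub_sq_ne_C {F : Type*} [Field F] (z : RatFunc F) (c : F) :
    RatFunc.X - z - z ^ 2 ≠ RatFunc.C c := by
  intro h
  have hz : IsIntegral F[X] z := by
    refine ⟨X ^ 2 + (X - C (X - C c)), ?_, ?_⟩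
    · exact monic_X_pow_add ((degree_X_sub_C (X - C c)).trans_lt (by norm_num))
    simp only [eval₂_sub, eval₂_add, eval₂_pow, eval₂_X, eval₂_C, map_sub,
      RatFunc.algebraMap_X, RatFunc.algebraMap_C]
    linear_combination -h
  obtain ⟨p, rfl⟩ := IsIntegrallyClosed.isIntegral_iff.mp hz
  have hp : p ^ 2 + p = X - C c := by
    apply RatFunc.algebraMap_injective F
    simp only [map_add, map_pow, map_sub, RatFunc.algebraMap_X, RatFunc.algebraMap_C]
    linear_combination -h
  have hd := congrArg natDegree hp
  rw [natDegree_X_sub_C] at hd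
  rcases Nat.eq_zero_or_pos p.natDegree with h0 | h0
  · rw [eq_C_of_natDegree_eq_zero h0, ← C_pow, ← C_add, natDegree_C] at hd
    omega
  · rw [natDegree_add_eq_left_of_natDegree_lt (by rw [natDegree_pow]; omega), natDegree_pow] at hd
    omega

theorem two_le_trdeg_of_transcendental {k F L : Type u} [Field k] [Field F] [Field L] [Algebra k F]
    [Algebra k L] [Algebra F L] [IsScalarTower k F L] {b : F} (hb : Transcendental k b) {c : L}
    (hc : Transcendental F c) {K : IntermediateField k L} (hbK : algebraMap F L b ∈ K)
    (hcK : c ∈ K) : 2 ≤ Algebra.trdeg k K := by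
  have h := AlgebraicIndependent.sumElim_comp
    (algebraicIndependent_unique_type_iff (ι := Unit) (x := fun _ => b).mpr hb)
    (algebraicIndependent_unique_type_iff (ι := Unit) (x := fun _ => c).mpr hc)
  have hK : AlgebraicIndependent k
      (Sum.elim (fun _ => ⟨c, hcK⟩) (fun _ => ⟨_, hbK⟩) : Unit ⊕ Unit → K) := by
    refine AlgebraicIndependent.of_comp K.val ?_
    convert h using 1
    ext (_ | _) <;> rfl
  have := hK.lift_cardinalMk_le_trdeg
  simpa [one_add_one_eq_two] using this

/-! ### Normal forms in characteristic two -/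

namespace WeierstrassCurve

/-- An isomorphism between curves `Y² + XY = X³ + a₂X² + a₆` has `u = 1` and `r = t = 0`, so it only
changes `a₂` by a value of the Artin-Schreier map. -/
theorem IsCharTwoJNeZeroNF.smul_eq {F : Type*} [Field F] [CharP F 2] {W : WeierstrassCurve F}
    {C : VariableChange F} [hW : W.IsCharTwoJNeZeroNF] [hC : (C • W).IsCharTwoJNeZeroNF] :
    (C • W).a₂ = W.a₂ - C.s - C.s ^ 2 ∧ (C • W).a₆ = W.a₆ := by
  have h2 : (2 : F) = 0 := CharP.cast_eq_zero F 2
  have h1 := hC.a₁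
  have h3 := hC.a₃
  have h4 := hC.a₄
  rw [variableChange_a₁, hW.a₁, h2, zero_mul, add_zero, mul_one] at h1
  rw [variableChange_a₃, hW.a₁, hW.a₃, h1, h2] at h3
  have hr : C.r = 0 := by linear_combination h3
  rw [variableChange_a₄, hW.a₁, hW.a₃, hW.a₄, h1, h2, hr] at h4
  have ht : C.t = 0 := by linear_combination -h4
  rw [variableChange_a₂, variableChange_a₆, hW.a₁, hW.a₃, hW.a₄, h1, hr, ht]
  constructor <;> ring

end WeierstrassCurve

namespace EllipticCurveOver

open WeierstrassCurve

/-- In characteristic two an elliptic curve is isomorphic to one with coefficients in a field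
generated by two elements. -/
theorem exists_isom_two_parameters {k L : Type*} [Field k] [Field L] [Algebra k L] [CharP L 2]
    (W : WeierstrassCurve L) [W.IsElliptic] :
    ∃ (C : VariableChange L) (p q : L), ∃ W' : WeierstrassCurve (IntermediateField.adjoin k {p, q}),
      W'.map (algebraMap _ L) = C • W := by
  -- It suffices to find `C` such that all coefficients of `C • W` lie in `k(p, q)`.
  suffices h : ∃ (C : VariableChange L) (p q : L), ∀ a ∈ ({(C • W).a₁, (C • W).a₂, (C • W).a₃,
      (C • W).a₄, (C • W).a₆} : Set L), a ∈ ({0, 1, p, q} : Set L) by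
    obtain ⟨C, p, q, h⟩ := h
    refine ⟨C, p, q, ?_⟩
    have hmem (a : L) (ha : a ∈ ({0, 1, p, q} : Set L)) :
        a ∈ IntermediateField.adjoin k {p, q} := by
      rcases ha with rfl | rfl | ha
      · exact zero_mem _
      · exact one_mem _
      · exact IntermediateField.subset_adjoin k _ ha
    simp only [Set.mem_insert_iff, Set.mem_singleton_iff, forall_eq_or_imp, forall_eq] at h
    exact ⟨⟨⟨_, hmem _ h.1⟩, ⟨_, hmem _ h.2.1⟩, ⟨_, hmem _ h.2.2.1⟩, ⟨_, hmem _ h.2.2.2.1⟩,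
      ⟨_, hmem _ h.2.2.2.2⟩⟩, rfl⟩
  obtain ⟨C, hC⟩ := W.exists_variableChange_isCharTwoNF
  obtain @hC | @hC := hC
  · exact ⟨C, (C • W).a₂, (C • W).a₆, by simp⟩
  by_cases h4 : (C • W).a₄ = 0
  · exact ⟨C, (C • W).a₃, (C • W).a₆, by simp [h4]⟩
  have h3 : (C • W).a₃ ≠ 0 := by
    intro h3
    have h := (C • W).isUnit_Δ.ne_zero
    rw [Δ_of_isCharTwoJEqZeroNF_of_char_two, h3] at h
    exact h (zero_pow four_ne_zero)
  -- Scaling by `u` replaces `a₃`, `a₄` by `a₃ / u³`, `a₄ / u⁴`, which agree for `u = a₄ / a₃`.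
  let D : VariableChange L := ⟨Units.mk0 _ (div_ne_zero h4 h3), 0, 0, 0⟩
  have hD1 : (D • C • W).a₁ = 0 := by simp [D, variableChange_a₁ _ D]
  have hD2 : (D • C • W).a₂ = 0 := by simp [D, variableChange_a₂ _ D]
  have hD34 : (D • C • W).a₃ = (D • C • W).a₄ := by
    simp only [D, variableChange_a₃ _ D, variableChange_a₄ _ D, Units.val_inv_eq_inv_val,
      Units.val_mk0, hC.a₁, hC.a₂]
    field_simp
    ring
  refine ⟨D * C, (D • C • W).a₄, (D • C • W).a₆, ?_⟩
  rw [mul_smul]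
  simp [hD1, hD2, hD34]

end EllipticCurveOver

/-! ### Descent of elliptic curves -/

namespace EllipticCurveOver

open WeierstrassCurve

variable {k : Type u} [Field k]

/-- The isomorphism class of an elliptic curve over `L`, as an element of the value at `L` of the
functor of isomorphism classes. -/
def isoClass {L : FieldExt k} (E : EllipticCurveOver L.carrier) :
    (isoClassFunctor (stackA1 k)).obj L :=
  Quotient.mk (isIsomorphicSetoid (EllipticCurveOver L.carrier)) E

theorem isoClass_surjective {L : FieldExt k} (a : (isoClassFunctor (stackA1 k)).obj L) :
    ∃ E : EllipticCurveOver L.carrier, isoClass E = a :=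
  Quotient.exists_rep a

theorem isoClass_eq_iff {L : FieldExt k} {E E' : EllipticCurveOver L.carrier} :
    isoClass E = isoClass E' ↔ ∃ C : VariableChange L.carrier, C • E.curve = E'.curve := by
  refine Quotient.eq.trans ⟨fun ⟨i⟩ => ⟨i.hom.change, i.hom.smul_eq⟩, fun ⟨C, hC⟩ => ⟨?_⟩⟩
  exact Groupoid.isoEquivHom E E' |>.symm ⟨C, hC⟩

/-- The model `W` over `K` need not be assumed elliptic: its discriminant is nonzero because it is so
after base change to `L`. -/
theorem descendsTo_isoClass_iff {L : FieldExt k} {E : EllipticCurveOver L.carrier}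
    {K : IntermediateField k L.carrier} :
    DescendsTo (isoClassFunctor (stackA1 k)) (isoClass E) K ↔
      ∃ (W : WeierstrassCurve K) (C : VariableChange L.carrier),
        C • W.map (algebraMap K L.carrier) = E.curve := by
  constructor
  · rintro ⟨b, hb⟩
    obtain ⟨E₀, rfl⟩ := isoClass_surjective b
    obtain ⟨C, hC⟩ := isoClass_eq_iff.mp (show isoClass
      ((EllipticCurveOver.baseChange (L.inclusion K).toRingHom).obj E₀) = isoClass E from hb)
    exact ⟨E₀.curve, C, hC⟩
  · rintro ⟨W, C, hC⟩
    have hW : W.IsElliptic := by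
      have := E.isElliptic
      rw [← hC] at this
      have h : (W.map (algebraMap K L.carrier)).IsElliptic := by
        rw [← inv_smul_smul C (W.map (algebraMap K L.carrier))]
        infer_instance
      have hΔ := h.isUnit.ne_zero
      rw [map_Δ] at hΔ
      exact ⟨(IsUnit.mk0 _ fun h0 => hΔ (by rw [h0, map_zero]))⟩
    exact ⟨isoClass (L := L.ofIntermediate K) ⟨W, hW⟩, isoClass_eq_iff.mpr ⟨C, hC⟩⟩

theorem elementEssentialDimension_le_two [CharP k 2] {L : FieldExt k}
    (a : (isoClassFunctor (stackA1 k)).obj L) :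
    elementEssentialDimension (isoClassFunctor (stackA1 k)) a ≤ 2 := by
  obtain ⟨E, rfl⟩ := isoClass_surjective a
  have := E.isElliptic
  have := charP_of_injective_algebraMap (algebraMap k L.carrier).injective 2
  obtain ⟨C, p, q, W, hW⟩ := exists_isom_two_parameters (k := k) E.curve
  refine iInf_le_of_le ⟨IntermediateField.adjoin k {p, q}, descendsTo_isoClass_iff.mpr
    ⟨W, C⁻¹, by rw [hW, inv_smul_smul]⟩⟩ ?_
  rw [Cardinal.toENat_le_ofNat]
  refine (IntermediateField.trdeg_adjoin_le _).trans ((Cardinal.mk_insert_le).trans ?_)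
  rw [Cardinal.mk_singleton, one_add_one_eq_two]

/-- If `Y² + XY = X³ + a₂X² + a₆` descends to `K`, then `K` contains `a₆`, and it contains `a₂` up to
the values of the Artin-Schreier map. -/
theorem mem_of_descendsTo [CharP k 2] {L : FieldExt k} {E : EllipticCurveOver L.carrier}
    [hE : E.curve.IsCharTwoJNeZeroNF] {K : IntermediateField k L.carrier}
    (h : DescendsTo (isoClassFunctor (stackA1 k)) (isoClass E) K) :
    E.curve.a₆ ∈ K ∧ ∃ z, E.curve.a₂ - z - z ^ 2 ∈ K := by
  have : CharP L.carrier 2 := charP_of_injective_algebraMap (algebraMap k L.carrier).injective 2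
  have : CharP K 2 := charP_of_injective_algebraMap (algebraMap k K).injective 2
  obtain ⟨W, C, hC⟩ := descendsTo_isoClass_iff.mp h
  -- The coefficient `a₁` is nonzero on both curves, so `W` has a normal form of the same shape.
  have h1 : W.a₁ ≠ 0 := by
    intro h0
    have := hE.a₁
    rw [← hC, variableChange_a₁, map_a₁, h0, map_zero,
      show (2 : L.carrier) = 0 from CharP.cast_eq_zero _ 2] at this
    simp at this
  let D := W.toCharTwoJNeZeroNF h1
  have hD : (D • W).IsCharTwoJNeZeroNF := W.toCharTwoJNeZeroNF_spec h1
  have hCD : (D.map (algebraMap K L.carrier) * C⁻¹) • E.curve =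
      (D • W).map (algebraMap K L.carrier) := by
    rw [← map_variableChange, ← hC, mul_smul, inv_smul_smul]
  have hN : ((D.map (algebraMap K L.carrier) * C⁻¹) • E.curve).IsCharTwoJNeZeroNF := by
    rw [hCD]
    exact ⟨by simp, by simp, by simp⟩
  obtain ⟨h2, h6⟩ := IsCharTwoJNeZeroNF.smul_eq (hC := hN)
  rw [hCD] at h2 h6
  rw [map_a₂] at h2
  rw [map_a₆] at h6
  refine ⟨?_, (D.map (algebraMap K L.carrier) * C⁻¹).s, ?_⟩
  · exact h6 ▸ (D • W).a₆.2
  · exact h2 ▸ (D • W).a₂.2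

theorem exists_two_le_elementEssentialDimension (k : Type u) [Field k] [CharP k 2] :
    ∃ (L : FieldExt k) (a : (isoClassFunctor (stackA1 k)).obj L),
      2 ≤ elementEssentialDimension (isoClassFunctor (stackA1 k)) a := by
  let F := RatFunc k
  let b : F := RatFunc.X
  have hb : Transcendental k b := RatFunc.transcendental_X
  have hb0 : RatFunc.C b ≠ 0 := by
    rw [map_ne_zero]
    exact RatFunc.X_ne_zero
  let L : FieldExt k := ⟨RatFunc F⟩
  have : CharP L.carrier 2 := charP_of_injective_algebraMap (algebraMap k L.carrier).injective 2
  let W : WeierstrassCurve L.carrier := ⟨1, (RatFunc.X : RatFunc F), 0, 0, RatFunc.C b⟩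
  have hW : W.IsCharTwoJNeZeroNF := ⟨rfl, rfl, rfl⟩
  let E : EllipticCurveOver L.carrier :=
    ⟨W, ⟨by rw [Δ_of_isCharTwoJNeZeroNF_of_char_two]; exact IsUnit.mk0 _ hb0⟩⟩
  have hE : E.curve.IsCharTwoJNeZeroNF := hW
  refine ⟨L, isoClass E, le_iInf fun ⟨K, hK⟩ => ?_⟩
  rw [Cardinal.ofNat_le_toENat]
  obtain ⟨h6, z, hz⟩ := mem_of_descendsTo hK
  exact two_le_trdeg_of_transcendental hb
    (RatFunc.transcendental_of_ne_C _ fun ⟨c, hc⟩ => ratFunc_X_sub_sub_sq_ne_C z c hc) h6 hz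

end EllipticCurveOver

theorem theoremA7 (k : Type u) [Field k] [CharP k 2] :
    stackEssentialDimension (stackA1 k) = 2 := by
  apply le_antisymm
  · refine iSup₂_le fun L a => ?_
    exact WithBot.coe_le_coe.mpr (EllipticCurveOver.elementEssentialDimension_le_two a)
  · obtain ⟨L, a, h⟩ := EllipticCurveOver.exists_two_le_elementEssentialDimension k
    exact le_iSup₂_of_le L a (WithBot.coe_le_coe.mpr h)
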